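/- Let $f_Z$ be a probability density on $[0,\infty)$ with Laplace transform $F(s)=\int_0^\infty e^{-sz}f_Z(z)\,dz$, and let $\Theta>0$ and $R>0$. Put $Q_m=\mathbb P\{z_1+\dots+z_m<\Theta\}$ for $m\ge 0$, where $z_1,z_2,\dots$ are independent with density $f_Z$ (so $Q_0=1$), and $P_m=Q_{m-1}-Q_m$ for $m\ge 1$. In persistent HARQ with effective channel $f_Z$, threshold $\Theta$ and rate $R$, every packet is transmitted, one transmission per timeslot, until it is decoded; the numbers $T_1,T_2,\dots$ of transmissions used for the successive packets are independent with $\mathbb P\{T_j=m\}=P_m$. Let $N_k=\#\{n\ge 1: T_1+\dots+T_n\le k\}$ be the number of packets decoded by timeslot $k$, and, for $\theta>0$, let $$C_{\rm eff}(\theta)=-\lim_{k\to\infty}\frac1{\theta k}\ln\mathbb E\{e^{-\theta R N_k}\}$$ be the effective capacity. Let $\psi=\log(\eta/\epsilon)/D_{\max}$ with $0<\epsilon<\eta$ and $D_{\max}>0$ (so $\psi>0$). Here $D_{\max}$ is the delay target, $\epsilon$ the limit on the delay violation probability, and $\eta$ the probability of a non-empty queue. Let $C_{\rm eff}(\psi)$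 denote $C_{\rm eff}(\theta^*)$, where $\theta^*>0$ solves $\theta^*C_{\rm eff}(\theta^*)=\psi$. Then the function $$s\mapsto\frac{e^{\psi}}{s}\,\frac{1-F(s)}{1-F(s)e^{\psi}}$$ is, on some right half-plane, the absolutely convergent Laplace transform of a function continuous on $(0,\infty)$. Writing $\mathcal L^{-1}_\Theta\{\cdot\}$ for the value of that function at $\Theta$, this value is real and greater than $1$. Finally, $C_{\rm eff}(\psi)$ exists, is unique, and equals $$C_{\rm eff}(\psi)=\frac{R}{\psi^{-1}\ln\left(\mathcal L_\Theta^{-1}\left\{\dfrac{e^{\psi}}{s}\,\dfrac{1-F(s)}{1-F(s)e^{\psi}}\right\}\right)} .$$ -/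

import Mathlib

open MeasureTheory ProbabilityTheory Filter Topology

noncomputable section

namespace HARQ

/-- The Laplace transform `∫₀^∞ e^{-st} g(t) dt`. -/
def laplace (g : ℝ → ℂ) (s : ℂ) : ℂ :=
  ∫ t in Set.Ioi (0 : ℝ), Complex.exp (-s * (t : ℂ)) * g t

/-- `g` is a continuous original of `H`: `g` is continuous on `(0, ∞)`, and on some right half-plane
its Laplace transform converges absolutely and equals `H`. -/
def IsLaplaceOriginal (H : ℂ → ℂ) (g : ℝ → ℂ) : Prop :=
  ContinuousOn g (Set.Ioi 0) ∧
    ∃ c : ℝ, ∀ s : ℂ, c < s.re →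
      IntegrableOn (fun t : ℝ => Complex.exp (-s * (t : ℂ)) * g t) (Set.Ioi 0) ∧ laplace g s = H s

open Classical in
/-- The inverse Laplace transform of `H` at the argument `x`: the value at `x` of the continuous
original of `H`. (On `(0, ∞)` there is at most one; if there is none, the value is `0`.) -/
def laplaceInv (H : ℂ → ℂ) (x : ℝ) : ℂ :=
  if h : ∃ g : ℝ → ℂ, IsLaplaceOriginal H g then h.choose x else 0

/-- `f` is a probability density on the half-line `[0, ∞)`. -/
structure IsChannelPdf (f : ℝ → ℝ) : Prop where
  measurable : Measurable f
  nonneg : ∀ z, 0 ≤ f z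
  eq_zero_of_neg : ∀ z, z < 0 → f z = 0
  lintegral_eq_one : ∫⁻ z, ENNReal.ofReal (f z) = 1

/-- The law on `ℝ` with density `f`. -/
def channelLaw (f : ℝ → ℝ) : Measure ℝ :=
  volume.withDensity (fun z => ENNReal.ofReal (f z))

/-- `Q_m = ℙ(z₁ + ⋯ + z_m < Θ)` for `z₁, …, z_m` independent with density `f`: the probability that
decoding has failed up to and including the `m`-th transmission. -/
def failureProb (f : ℝ → ℝ) (Θ : ℝ) (m : ℕ) : ℝ :=
  (Measure.pi (fun _ : Fin m => channelLaw f)).real {z | ∑ i, z i < Θ}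

/-- `P_m = Q_{m-1} - Q_m` (for `m ≥ 1`): the probability that a packet is decoded error-free at the
`m`-th transmission. -/
def decodeProb (f : ℝ → ℝ) (Θ : ℝ) (m : ℕ) : ℝ :=
  failureProb f Θ (m - 1) - failureProb f Θ m

/-- `T 0, T 1, …` are the durations, in timeslots, of the successive transmission cycles of
persistent HARQ with effective channel density `f` and threshold `Θ`: each packet is transmitted
until it is decoded, one transmission per timeslot, the cycles are independent, and a cycle lasts
`m ≥ 1` transmissions with probability `P_m`. -/
structure IsPersistentHARQ {Ω : Type*} [MeasurableSpace Ω] (μ : Measure Ω) (f : ℝ → ℝ) (Θ : ℝ)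
    (T : ℕ → Ω → ℕ) : Prop where
  measurable : ∀ j, Measurable (T j)
  indep : iIndepFun T μ
  law : ∀ j m, 1 ≤ m → μ.real {ω | T j ω = m} = decodeProb f Θ m

/-- `N_k`: the number of packets decoded by timeslot `k`, that is, the number of `n ≥ 1` such that
the first `n` cycles last at most `k` slots in total. (A cycle lasts at least one slot, so that only
`n ≤ k` can contribute.) -/
def decodedPackets {Ω : Type*} (T : ℕ → Ω → ℕ) (k : ℕ) (ω : Ω) : ℕ :=
  ((Finset.Icc 1 k).filter (fun n => ∑ i ∈ Finset.range n, T i ω ≤ k)).card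

/-- The effective capacity exists for the QoS-exponent `θ` and equals `C`:
`C = - lim_{k → ∞} (1 / (θ k)) ln 𝔼[exp(-θ R N_k)]`. -/
def IsEffectiveCapacity {Ω : Type*} [MeasurableSpace Ω] (μ : Measure Ω) (R : ℝ)
    (N : ℕ → Ω → ℕ) (θ C : ℝ) : Prop :=
  Tendsto (fun k : ℕ => -(1 / (θ * (k : ℝ)) * Real.log (∫ ω, Real.exp (-θ * R * (N k ω : ℝ)) ∂μ)))
    atTop (𝓝 C)

/-- `ψ = log(η/ε) / D_max`, with `η` the probability of a non-empty queue, `ε` the limit on the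
delay violation probability and `D` the delay target. -/
def qosParameter (η ε D : ℝ) : ℝ := Real.log (η / ε) / D

/-- `C` is the effective capacity expressed in the QoS-parameter `ψ`: it is the effective capacity
`C_eff(θ*)` for a QoS-exponent `θ* > 0` that solves `θ* C_eff(θ*) = ψ`. -/
def IsEffectiveCapacityAt {Ω : Type*} [MeasurableSpace Ω] (μ : Measure Ω) (R : ℝ)
    (N : ℕ → Ω → ℕ) (ψ C : ℝ) : Prop :=
  ∃ θ : ℝ, 0 < θ ∧ IsEffectiveCapacity μ R N θ C ∧ θ * C = ψ

/-- The function `s ↦ (e^ψ / s) (1 - F(s)) / (1 - F(s) e^ψ)`, with `F` the Laplace transform of the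
density `f`. -/
def capacityTransform (f : ℝ → ℝ) (ψ : ℝ) (s : ℂ) : ℂ :=
  Complex.exp (ψ : ℂ) / s * ((1 - laplace (fun z => (f z : ℂ)) s) /
    (1 - laplace (fun z => (f z : ℂ)) s * Complex.exp (ψ : ℂ)))

end HARQ

end

/-! Everything passes through the exponential moment `M(l) = ∑ e^{lm} P_m` of a cycle (`expMoment`).

Inversion: by independence, the Laplace transform of `Q_m` in the threshold is `F^m / s`, so that of
`P_m` is `F^{m-1}(1 - F) / s`, and the geometric series with ratio `e^ψ F` sums to the given
transform. The Chernoff bound `Q_m ≤ e^{ct} r^m`, where `r → 0` as `c → ∞`, makes `M` finite at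
every `l` and justifies the exchange of sum and integral. Hence `M(ψ)`, as a function of the
threshold, is the continuous original (`isLaplaceOriginal_expMoment`), unique by Fourier inversion.

Capacity: conditioning on the first cycle gives a renewal equation for `𝔼[e^{-aN_k}]`. If `M(l) =
e^a`, then `e^{-lk}` balances it up to boundary terms, so the expectation decays at rate `l`
(`packetTransform_le`, `le_packetTransform`). With `a = θR` this yields `θ C_eff(θ) = l`. The
condition `l = ψ` forces `θR = ln M(ψ)`, whence `C_eff = ψ/θ = Rψ / ln M(ψ)`. -/

namespace HARQ

/-! ### Uniqueness of continuous Laplace originals -/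

/-- An absolutely convergent Laplace transform that vanishes on a half-plane has a vanishing
original at every positive point of continuity. -/
theorem eq_zero_of_laplace_eq_zero {d : ℝ → ℂ} (hd : ContinuousOn d (Set.Ioi 0)) {c : ℝ}
    (hint : IntegrableOn (fun t : ℝ => Complex.exp (-(c : ℂ) * (t : ℂ)) * d t) (Set.Ioi 0))
    (h0 : ∀ s : ℂ, s.re = c → laplace d s = 0) {x : ℝ} (hx : 0 < x) : d x = 0 := by
  -- On the line `Re s = c` the Laplace transform of `d` is the Fourier transform of `D`, with `s =
  -- c + 2πiw`; Fourier inversion at a point of continuity then gives `D x = 0`.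
  set D : ℝ → ℂ := (Set.Ioi (0 : ℝ)).indicator
    (fun t : ℝ => Complex.exp (-(c : ℂ) * (t : ℂ)) * d t) with hD
  have hDint : Integrable D := (integrable_indicator_iff measurableSet_Ioi).2 hint
  have hF : FourierTransform.fourier D = fun _ => (0 : ℂ) := by
    funext w
    rw [Real.fourier_eq']
    have := h0 (c + 2 * Real.pi * w * Complex.I) (by simp)
    rw [laplace, ← integral_indicator measurableSet_Ioi] at this
    rw [← this]
    congr 1
    funext t
    by_cases ht : t ∈ Set.Ioi (0 : ℝ)
    · simp only [hD, Set.indicator_of_mem ht, smul_eq_mul]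
      rw [← mul_assoc, ← Complex.exp_add]
      congr 2
      simp
      ring
    · simp [hD, Set.indicator_of_notMem ht]
  have hcont : ContinuousAt D x := by
    have h1 : ContinuousAt (fun t : ℝ => Complex.exp (-(c : ℂ) * (t : ℂ)) * d t) x :=
      ContinuousAt.mul (by fun_prop) (hd.continuousAt (Ioi_mem_nhds hx))
    refine h1.congr ?_
    filter_upwards [Ioi_mem_nhds hx] with t ht
    rw [hD, Set.indicator_of_mem ht]
  have h := hDint.fourierInv_fourier_eq (by rw [hF]; exact integrable_zero _ _ _) hcont
  rw [hF] at h
  have h2 : D x = 0 := by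
    rw [← h, Real.fourierInv_eq']
    simp
  rw [hD, Set.indicator_of_mem (show x ∈ Set.Ioi (0 : ℝ) from hx)] at h2
  simpa using h2

/-- Continuous originals are unique on `(0, ∞)`. -/
theorem IsLaplaceOriginal.eqOn {H : ℂ → ℂ} {g₁ g₂ : ℝ → ℂ} (h₁ : IsLaplaceOriginal H g₁)
    (h₂ : IsLaplaceOriginal H g₂) : Set.EqOn g₁ g₂ (Set.Ioi 0) := by
  obtain ⟨hc₁, c₁, h₁⟩ := h₁
  obtain ⟨hc₂, c₂, h₂⟩ := h₂
  intro x hx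
  have key : ∀ s : ℂ, s.re = max c₁ c₂ + 1 →
      IntegrableOn (fun t : ℝ => Complex.exp (-s * (t : ℂ)) * (g₁ t - g₂ t)) (Set.Ioi 0) ∧
        laplace (fun t => g₁ t - g₂ t) s = 0 := by
    intro s hs
    obtain ⟨i₁, e₁⟩ := h₁ s (by rw [hs]; linarith [le_max_left c₁ c₂])
    obtain ⟨i₂, e₂⟩ := h₂ s (by rw [hs]; linarith [le_max_right c₁ c₂])
    constructor
    · simp only [mul_sub]
      exact i₁.sub i₂
    · simp only [laplace, mul_sub]
      rw [integral_sub i₁ i₂]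
      simp only [laplace] at e₁ e₂
      rw [e₁, e₂, sub_self]
  have h3 := eq_zero_of_laplace_eq_zero (d := fun t => g₁ t - g₂ t) (hc₁.sub hc₂)
    (key (max c₁ c₂ + 1 : ℝ) (by simp)).1 (fun s hs => (key s hs).2) hx
  exact sub_eq_zero.1 h3

theorem isLaplaceOriginal_laplaceInv {H : ℂ → ℂ} {g : ℝ → ℂ} (h : IsLaplaceOriginal H g) :
    IsLaplaceOriginal H (laplaceInv H) := by
  have hex : ∃ g : ℝ → ℂ, IsLaplaceOriginal H g := ⟨g, h⟩
  have : laplaceInv H = hex.choose := by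
    funext x
    rw [laplaceInv, dif_pos hex]
  rw [this]
  exact hex.choose_spec

/-! ### The channel law and its Laplace transform -/

/-- The real Laplace transform of the channel law. -/
noncomputable def realLaplace (f : ℝ → ℝ) (c : ℝ) : ℝ := ∫ z, Real.exp (-c * z) ∂channelLaw f

variable {f : ℝ → ℝ}

theorem IsChannelPdf.isProbabilityMeasure (hf : IsChannelPdf f) :
    IsProbabilityMeasure (channelLaw f) := by
  constructor
  rw [channelLaw, withDensity_apply _ MeasurableSet.univ, setLIntegral_univ]
  exact hf.lintegral_eq_one

theorem channelLaw_absolutelyContinuous (f : ℝ → ℝ) : channelLaw f ≪ volume :=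
  withDensity_absolutelyContinuous _ _

theorem IsChannelPdf.ae_pos (hf : IsChannelPdf f) : ∀ᵐ z ∂channelLaw f, 0 < z := by
  rw [channelLaw, ae_withDensity_iff hf.measurable.ennreal_ofReal]
  have h0 : ∀ᵐ z : ℝ, z ≠ 0 := by simp [ae_iff]
  filter_upwards [h0] with z hz h
  by_contra hneg
  have : z < 0 := lt_of_le_of_ne (not_lt.1 hneg) hz
  exact h (by rw [hf.eq_zero_of_neg z this, ENNReal.ofReal_zero])

theorem IsChannelPdf.laplace_eq (hf : IsChannelPdf f) (s : ℂ) :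
    laplace (fun z => (f z : ℂ)) s = ∫ z, Complex.exp (-s * (z : ℂ)) ∂channelLaw f := by
  rw [channelLaw, integral_withDensity_eq_integral_toReal_smul hf.measurable.ennreal_ofReal
    (Eventually.of_forall fun _ => ENNReal.ofReal_lt_top), laplace,
    ← integral_indicator measurableSet_Ioi]
  refine integral_congr_ae ?_
  have h0 : ∀ᵐ z : ℝ, z ≠ 0 := by simp [ae_iff]
  filter_upwards [h0] with z hz
  by_cases hzp : z ∈ Set.Ioi (0 : ℝ)
  · rw [Set.indicator_of_mem hzp, ENNReal.toReal_ofReal (hf.nonneg z), Complex.real_smul, mul_comm]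
  · have : z < 0 := lt_of_le_of_ne (not_lt.1 hzp) hz
    rw [Set.indicator_of_notMem hzp, hf.eq_zero_of_neg z this]
    simp

theorem IsChannelPdf.integrable_real_exp (hf : IsChannelPdf f) {c : ℝ} (hc : 0 ≤ c) :
    Integrable (fun z : ℝ => Real.exp (-c * z)) (channelLaw f) := by
  have := hf.isProbabilityMeasure
  refine Integrable.mono' (integrable_const (1 : ℝ)) (by fun_prop) ?_
  filter_upwards [hf.ae_pos] with z hz
  rw [Real.norm_eq_abs, Real.abs_exp, Real.exp_le_one_iff]
  have := mul_nonneg hc hz.le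
  linarith

theorem realLaplace_nonneg (f : ℝ → ℝ) (c : ℝ) : 0 ≤ realLaplace f c :=
  integral_nonneg fun _ => (Real.exp_pos _).le

theorem IsChannelPdf.norm_laplace_le (hf : IsChannelPdf f) {c : ℝ} (hc : 0 ≤ c) {s : ℂ}
    (hs : c ≤ s.re) : ‖laplace (fun z => (f z : ℂ)) s‖ ≤ realLaplace f c := by
  rw [hf.laplace_eq, realLaplace]
  refine norm_integral_le_of_norm_le (hf.integrable_real_exp hc) ?_
  filter_upwards [hf.ae_pos] with z hz
  rw [Complex.norm_exp, Real.exp_le_exp]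
  simp
  exact mul_le_mul_of_nonneg_right hs hz.le

/-- The law has no atom at `0`, so `e^{-cz} → 0` almost surely, dominated by `1`. -/
theorem IsChannelPdf.tendsto_realLaplace (hf : IsChannelPdf f) :
    Tendsto (realLaplace f) atTop (𝓝 0) := by
  have := hf.isProbabilityMeasure
  have h := tendsto_integral_filter_of_dominated_convergence (μ := channelLaw f) (l := atTop)
    (F := fun (c : ℝ) (z : ℝ) => Real.exp (-c * z)) (f := fun _ => 0) (fun _ => 1)
    (Eventually.of_forall fun c => by fun_prop)
    (by
      filter_upwards [eventually_ge_atTop 0] with c hc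
      filter_upwards [hf.ae_pos] with z hz
      rw [Real.norm_eq_abs, Real.abs_exp, Real.exp_le_one_iff]
      have := mul_nonneg hc hz.le
      linarith)
    (integrable_const _)
    (by
      filter_upwards [hf.ae_pos] with z hz
      refine Real.tendsto_exp_atBot.comp ?_
      simp only [neg_mul]
      exact tendsto_neg_atTop_atBot.comp (tendsto_id.atTop_mul_const hz))
  rw [integral_zero] at h
  exact h

theorem IsChannelPdf.exists_realLaplace_lt (hf : IsChannelPdf f) {ψ : ℝ} :
    ∃ c : ℝ, 0 < c ∧ Real.exp ψ * realLaplace f c < 1 := by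
  have h := hf.tendsto_realLaplace.const_mul (Real.exp ψ)
  rw [mul_zero] at h
  obtain ⟨c, h1, h2⟩ := ((h.eventually_lt_const one_pos).and (eventually_gt_atTop 0)).exists
  exact ⟨c, h2, h1⟩

/-! ### Failure probabilities as functions of the threshold -/

/-- The joint law of `m` independent channel realizations. -/
noncomputable def jointLaw (f : ℝ → ℝ) (m : ℕ) : Measure (Fin m → ℝ) :=
  Measure.pi (fun _ : Fin m => channelLaw f)

theorem IsChannelPdf.isProbabilityMeasure_jointLaw (hf : IsChannelPdf f) (m : ℕ) :
    IsProbabilityMeasure (jointLaw f m) := by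
  have := hf.isProbabilityMeasure
  unfold jointLaw
  infer_instance

theorem IsChannelPdf.ae_sum_nonneg (hf : IsChannelPdf f) (m : ℕ) :
    ∀ᵐ z ∂jointLaw f m, 0 ≤ ∑ i, z i := by
  have := hf.isProbabilityMeasure
  have h : ∀ᵐ z ∂jointLaw f m, ∀ i, 0 < z i :=
    ae_all_iff.2 fun i => (Measure.tendsto_eval_ae_ae (μ := fun _ : Fin m => channelLaw f)
      (i := i)).eventually hf.ae_pos
  filter_upwards [h] with z hz
  exact Finset.sum_nonneg fun i _ => (hz i).le

theorem measurableSet_sum_lt (m : ℕ) (t : ℝ) :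
    MeasurableSet {z : Fin m → ℝ | ∑ i, z i < t} :=
  measurableSet_lt (by fun_prop) measurable_const

theorem failureProb_eq (f : ℝ → ℝ) (t : ℝ) (m : ℕ) :
    failureProb f t m = (jointLaw f m).real {z | ∑ i, z i < t} := rfl

theorem failureProb_nonneg (f : ℝ → ℝ) (t : ℝ) (m : ℕ) : 0 ≤ failureProb f t m :=
  measureReal_nonneg

theorem failureProb_zero {t : ℝ} (ht : 0 < t) : failureProb f t 0 = 1 := by
  simp [failureProb, ht, measureReal_def]

theorem IsChannelPdf.failureProb_mono (hf : IsChannelPdf f) (m : ℕ) :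
    Monotone fun t => failureProb f t m := by
  intro a b hab
  have := hf.isProbabilityMeasure_jointLaw m
  exact measureReal_mono (μ := jointLaw f m) (fun z (hz : _ < a) => lt_of_lt_of_le hz hab)

theorem IsChannelPdf.failureProb_le_one (hf : IsChannelPdf f) (t : ℝ) (m : ℕ) :
    failureProb f t m ≤ 1 := by
  have := hf.isProbabilityMeasure_jointLaw m
  exact measureReal_le_one (μ := jointLaw f m)

/-- Chernoff bound: the indicator of `S < t` is at most `e^{c(t - S)}`, whose expectation
factorizes. -/
theorem IsChannelPdf.failureProb_le (hf : IsChannelPdf f) {c : ℝ} (hc : 0 ≤ c) (t : ℝ) (m : ℕ) :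
    failureProb f t m ≤ Real.exp (c * t) * realLaplace f c ^ m := by
  have := hf.isProbabilityMeasure
  have := hf.isProbabilityMeasure_jointLaw m
  have hprod : ∀ z : Fin m → ℝ,
      Real.exp (c * t) * ∏ i, Real.exp (-c * z i) = Real.exp (c * (t - ∑ i, z i)) := by
    intro z
    rw [← Real.exp_sum, ← Real.exp_add, ← Finset.mul_sum]
    congr 1
    ring
  have hI : Integrable (fun z : Fin m → ℝ => Real.exp (c * t) * ∏ i, Real.exp (-c * z i))
      (jointLaw f m) :=
    (Integrable.fintype_prod (μ := fun _ : Fin m => channelLaw f)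
      (f := fun _ z => Real.exp (-c * z)) fun _ => hf.integrable_real_exp hc).const_mul _
  calc failureProb f t m
      = ∫ z, Set.indicator {z : Fin m → ℝ | ∑ i, z i < t} 1 z ∂jointLaw f m := by
        rw [integral_indicator_one (measurableSet_sum_lt m t), failureProb_eq]
    _ ≤ ∫ z : Fin m → ℝ, Real.exp (c * t) * ∏ i, Real.exp (-c * z i) ∂jointLaw f m := by
        refine integral_mono ((integrable_const (1 : ℝ)).indicator (measurableSet_sum_lt m t)) hI ?_
        intro z
        simp only [hprod]
        by_cases hz : z ∈ {z : Fin m → ℝ | ∑ i, z i < t}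
        · rw [Set.indicator_of_mem hz]
          exact Real.one_le_exp (mul_nonneg hc (sub_nonneg.2 (le_of_lt hz)))
        · rw [Set.indicator_of_notMem hz]
          exact (Real.exp_pos _).le
    _ = _ := by
        rw [integral_const_mul, jointLaw, integral_fintype_prod_eq_prod
          (fun _ z => Real.exp (-c * z))]
        simp [realLaplace]

/-- By Fubini: once the other coordinates are fixed, the first is confined to a single point. An
empty sum would have an atom at `0`, hence `m + 1`. -/
theorem IsChannelPdf.jointLaw_sum_eq (hf : IsChannelPdf f) (m : ℕ) (t : ℝ) :
    jointLaw f (m + 1) {z | ∑ i, z i = t} = 0 := by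
  have := hf.isProbabilityMeasure
  have hmp := (measurePreserving_piFinSuccAbove (fun _ : Fin (m + 1) => channelLaw f) 0)
  have hS : MeasurableSet {p : ℝ × (Fin m → ℝ) | p.1 + ∑ i, p.2 i = t} :=
    measurableSet_eq_fun (by fun_prop) measurable_const
  have h1 : {z : Fin (m + 1) → ℝ | ∑ i, z i = t} =
      (MeasurableEquiv.piFinSuccAbove (fun _ : Fin (m + 1) => ℝ) 0) ⁻¹'
        {p : ℝ × (Fin m → ℝ) | p.1 + ∑ i, p.2 i = t} := by
    ext z
    simp [Fin.sum_univ_succ, MeasurableEquiv.piFinSuccAbove, Fin.tail]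
  rw [h1, jointLaw, hmp.measure_preimage hS.nullMeasurableSet]
  rw [← Measure.prod_swap, Measure.map_apply measurable_swap hS,
    Measure.measure_prod_null (measurable_swap hS)]
  refine Eventually.of_forall fun z => ?_
  refine channelLaw_absolutelyContinuous f ?_
  refine measure_mono_null (t := {t - ∑ i, z i}) ?_ (by simp)
  intro y hy
  have : y + ∑ i, z i = t := hy
  simp [← this]

/-- For `m = 0` this is a step function jumping at `0`, hence the restriction to `(0, ∞)`. For `m ≥
1` the indicator of `S < t` is continuous in `t` off the null set `S = t`. -/
theorem IsChannelPdf.continuousOn_failureProb (hf : IsChannelPdf f) (m : ℕ) :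
    ContinuousOn (fun t => failureProb f t m) (Set.Ioi 0) := by
  rcases m with _ | m
  · exact continuousOn_const.congr fun t ht => failureProb_zero ht
  · have := hf.isProbabilityMeasure_jointLaw (m + 1)
    refine Continuous.continuousOn (continuous_iff_continuousAt.2 fun t => ?_)
    have heq : (fun t => failureProb f t (m + 1)) = fun t =>
        ∫ z, Set.indicator {z : Fin (m + 1) → ℝ | ∑ i, z i < t} (fun _ => (1 : ℝ)) z
          ∂jointLaw f (m + 1) := by
      funext t
      rw [failureProb_eq]
      exact (integral_indicator_one (measurableSet_sum_lt _ t)).symm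
    rw [heq]
    refine tendsto_integral_filter_of_dominated_convergence (fun _ => 1)
      (Eventually.of_forall fun u => (measurable_const.indicator
        (measurableSet_sum_lt _ u)).aestronglyMeasurable)
      (Eventually.of_forall fun u => Eventually.of_forall fun z => ?_) (integrable_const _) ?_
    · refine (norm_indicator_le_norm_self _ _).trans (by simp)
    · have : ∀ᵐ z ∂jointLaw f (m + 1), ∑ i, z i ≠ t := by
        rw [ae_iff]
        simpa using hf.jointLaw_sum_eq m t
      filter_upwards [this] with z hz
      refine tendsto_const_nhds.congr' ?_
      rcases lt_or_gt_of_ne hz with h | h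
      · filter_upwards [Ioi_mem_nhds h] with u hu
        rw [Set.indicator_of_mem (by exact h), Set.indicator_of_mem (by exact hu)]
      · filter_upwards [Iio_mem_nhds h] with u hu
        rw [Set.indicator_of_notMem (by exact not_lt.2 h.le),
          Set.indicator_of_notMem (by exact not_lt.2 (le_of_lt (show u < _ from hu)))]

theorem integrableOn_exp_neg_mul {s : ℂ} (hs : 0 < s.re) :
    IntegrableOn (fun t : ℝ => Complex.exp (-s * (t : ℂ))) (Set.Ioi 0) :=
  integrableOn_exp_mul_complex_Ioi (by simpa using hs) 0

theorem IsChannelPdf.integrableOn_exp_mul_failureProb (hf : IsChannelPdf f) {s : ℂ}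
    (hs : 0 < s.re) (m : ℕ) : IntegrableOn
      (fun t : ℝ => Complex.exp (-s * (t : ℂ)) * (failureProb f t m : ℂ)) (Set.Ioi 0) := by
  refine Integrable.mul_bdd (c := 1) (integrableOn_exp_neg_mul hs) ?_ ?_
  · exact (Complex.measurable_ofReal.comp (hf.failureProb_mono m).measurable).aestronglyMeasurable
  · refine Eventually.of_forall fun t => ?_
    rw [Complex.norm_real, Real.norm_of_nonneg (failureProb_nonneg f t m)]
    exact hf.failureProb_le_one t m

/-- The Laplace transform of `t ↦ ℙ(z₁ + ⋯ + z_m < t)` is `F(s)^m / s`. -/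
theorem IsChannelPdf.laplace_failureProb (hf : IsChannelPdf f) {s : ℂ} (hs : 0 < s.re) (m : ℕ) :
    laplace (fun t => (failureProb f t m : ℂ)) s = laplace (fun z => (f z : ℂ)) s ^ m / s := by
  have := hf.isProbabilityMeasure
  have := hf.isProbabilityMeasure_jointLaw m
  set G : ℝ → (Fin m → ℝ) → ℂ := fun t z =>
    Set.indicator {z : Fin m → ℝ | ∑ i, z i < t} (fun _ => Complex.exp (-s * (t : ℂ))) z with hG
  have hmeas : MeasurableSet {p : ℝ × (Fin m → ℝ) | ∑ i, p.2 i < p.1} :=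
    measurableSet_lt (by fun_prop) measurable_fst
  have hGint : Integrable (Function.uncurry G)
      ((volume.restrict (Set.Ioi (0 : ℝ))).prod (jointLaw f m)) := by
    have h1 : Integrable (fun p : ℝ × (Fin m → ℝ) => Complex.exp (-s * (p.1 : ℂ)) * 1)
        ((volume.restrict (Set.Ioi (0 : ℝ))).prod (jointLaw f m)) :=
      Integrable.mul_prod (integrableOn_exp_neg_mul hs) (integrable_const (1 : ℂ))
    refine (h1.indicator hmeas).congr (Eventually.of_forall fun p => ?_)
    by_cases hp : ∑ i, p.2 i < p.1 <;> simp [hG, Function.uncurry, Set.indicator, hp]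
  calc laplace (fun t => (failureProb f t m : ℂ)) s
      = ∫ t in Set.Ioi (0 : ℝ), ∫ z, G t z ∂jointLaw f m := by
        rw [laplace]
        congr 1
        funext t
        simp only [hG]
        rw [integral_indicator_const _ (measurableSet_sum_lt m t), Complex.real_smul, mul_comm,
          failureProb_eq]
    _ = ∫ z, (∫ t in Set.Ioi (0 : ℝ), G t z) ∂jointLaw f m := integral_integral_swap hGint
    _ = ∫ z : Fin m → ℝ, (∏ i, Complex.exp (-s * (z i : ℂ))) / s ∂jointLaw f m := by
        -- Since `S ≥ 0` almost surely, the inner integral runs over all of `(S, ∞)` and equals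
        -- `e^{-sS} / s`.
        refine integral_congr_ae ?_
        filter_upwards [hf.ae_sum_nonneg m] with z hz
        have h2 : (fun t : ℝ => G t z) = Set.indicator (Set.Ioi (∑ i, z i))
            (fun t : ℝ => Complex.exp (-s * (t : ℂ))) := by
          funext t
          simp only [hG, Set.indicator, Set.mem_ofPred_eq, Set.mem_Ioi]
        rw [h2, setIntegral_indicator measurableSet_Ioi, Set.Ioi_inter_Ioi, sup_eq_right.2 hz,
          integral_exp_mul_complex_Ioi (by simpa using hs), ← Complex.exp_sum, ← Finset.mul_sum,
          ← Complex.ofReal_sum, neg_div_neg_eq]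
    _ = _ := by
        rw [integral_div, jointLaw, integral_fintype_prod_eq_prod
          (fun _ (z : ℝ) => Complex.exp (-s * (z : ℂ)))]
        simp [hf.laplace_eq]

/-! ### The exponential moment as Laplace original -/

/-- The exponential moment `∑_{m ≥ 1} e^{ψ m} P_m` of the cycle length at threshold `t`. -/
noncomputable def expMoment (f : ℝ → ℝ) (ψ t : ℝ) : ℝ :=
  ∑' m : ℕ, Real.exp (ψ * (m + 1)) * decodeProb f t (m + 1)

theorem decodeProb_succ (f : ℝ → ℝ) (t : ℝ) (m : ℕ) :
    decodeProb f t (m + 1) = failureProb f t m - failureProb f t (m + 1) := rfl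

/-- Chernoff applied to both terms of `Q_m - Q_{m+1}`. The bound is geometric with ratio `e^ψ r`,
which is below `1` for large `c`. -/
theorem IsChannelPdf.norm_expMoment_term_le (hf : IsChannelPdf f) {c : ℝ} (hc : 0 ≤ c)
    (ψ t : ℝ) (m : ℕ) :
    ‖Real.exp (ψ * (m + 1)) * decodeProb f t (m + 1)‖ ≤
      Real.exp ψ * (1 + realLaplace f c) * Real.exp (c * t) *
        (Real.exp ψ * realLaplace f c) ^ m := by
  have h1 := hf.failureProb_le hc t m
  have h2 := hf.failureProb_le hc t (m + 1)
  have h3 : |decodeProb f t (m + 1)| ≤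
      Real.exp (c * t) * realLaplace f c ^ m * (1 + realLaplace f c) := by
    rw [decodeProb_succ, abs_le]
    have := failureProb_nonneg f t m
    have := failureProb_nonneg f t (m + 1)
    have : Real.exp (c * t) * realLaplace f c ^ m * (1 + realLaplace f c) =
      Real.exp (c * t) * realLaplace f c ^ m + Real.exp (c * t) * realLaplace f c ^ (m + 1) := by
      ring
    constructor <;> linarith
  rw [norm_mul, Real.norm_eq_abs, Real.abs_exp, Real.norm_eq_abs]
  calc Real.exp (ψ * (m + 1)) * |decodeProb f t (m + 1)|
      ≤ Real.exp (ψ * (m + 1)) *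
        (Real.exp (c * t) * realLaplace f c ^ m * (1 + realLaplace f c)) := by gcongr
    _ = _ := by
      rw [mul_pow, ← Real.exp_nat_mul, mul_add, mul_one, Real.exp_add, mul_comm ψ]
      ring

theorem IsChannelPdf.summable_expMoment (hf : IsChannelPdf f) (ψ t : ℝ) :
    Summable fun m : ℕ => Real.exp (ψ * (m + 1)) * decodeProb f t (m + 1) := by
  obtain ⟨c, hc, hlt⟩ := hf.exists_realLaplace_lt (ψ := ψ)
  exact Summable.of_norm_bounded ((summable_geometric_of_lt_one
    (mul_nonneg (Real.exp_pos _).le (realLaplace_nonneg f c)) hlt).mul_left _)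
    (hf.norm_expMoment_term_le hc.le ψ t)

theorem IsChannelPdf.continuousOn_expMoment (hf : IsChannelPdf f) (ψ : ℝ) :
    ContinuousOn (expMoment f ψ) (Set.Ioi 0) := by
  obtain ⟨c, hc, hlt⟩ := hf.exists_realLaplace_lt (ψ := ψ)
  intro x hx
  -- The majorant grows like `e^{ct}`, so uniform convergence is only available on bounded
  -- intervals.
  have h : ContinuousOn (expMoment f ψ) (Set.Ioo 0 (x + 1)) := by
    refine continuousOn_tsum (u := fun m : ℕ => Real.exp ψ * (1 + realLaplace f c) *
      Real.exp (c * (x + 1)) * (Real.exp ψ * realLaplace f c) ^ m) (fun m => ?_) ?_ ?_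
    · refine continuousOn_const.mul ?_
      simp only [decodeProb_succ]
      exact ((hf.continuousOn_failureProb m).sub (hf.continuousOn_failureProb (m + 1))).mono
        Set.Ioo_subset_Ioi_self
    · exact (summable_geometric_of_lt_one
        (mul_nonneg (Real.exp_pos _).le (realLaplace_nonneg f c)) hlt).mul_left _
    · intro m t ht
      refine (hf.norm_expMoment_term_le hc.le ψ t m).trans ?_
      have := realLaplace_nonneg f c
      have := ht.2
      gcongr
  exact (h.continuousAt (Ioo_mem_nhds hx (by linarith))).continuousWithinAt

/-- The exponential moment of the cycle length, as a function of the threshold, is a continuous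
original of the capacity transform. -/
theorem IsChannelPdf.isLaplaceOriginal_expMoment (hf : IsChannelPdf f) (ψ : ℝ) :
    IsLaplaceOriginal (capacityTransform f ψ) (fun t => (expMoment f ψ t : ℂ)) := by
  have hcont : ContinuousOn (fun t => (expMoment f ψ t : ℂ)) (Set.Ioi 0) :=
    Complex.continuous_ofReal.comp_continuousOn (hf.continuousOn_expMoment ψ)
  obtain ⟨c, hc, hlt⟩ := hf.exists_realLaplace_lt (ψ := ψ)
  refine ⟨hcont, c, fun s hs => ?_⟩
  have hs0 : 0 < s.re := hc.trans hs
  set r := realLaplace f c with hr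
  have hr0 : 0 ≤ r := realLaplace_nonneg f c
  set ρ := Real.exp ψ * r with hρ
  have hρ0 : 0 ≤ ρ := by positivity
  set F := laplace (fun z => (f z : ℂ)) s with hF
  set K := Real.exp ψ * (1 + r)
  have hgeo := summable_geometric_of_lt_one hρ0 hlt
  set A : ℕ → ℝ → ℂ := fun m t => Complex.exp (-s * (t : ℂ)) *
    ((Real.exp (ψ * (m + 1)) * decodeProb f t (m + 1) : ℝ) : ℂ) with hA
  have hexp : ∀ t : ℝ, ‖Complex.exp (-s * (t : ℂ))‖ = Real.exp (-s.re * t) := by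
    intro t
    rw [Complex.norm_exp]
    simp
  -- The condition `Re s > c` beats the growth `e^{ct}` of the Chernoff bound.
  have hAle : ∀ m t, ‖A m t‖ ≤ K * ρ ^ m * Real.exp (-(s.re - c) * t) := by
    intro m t
    rw [hA, norm_mul, hexp, Complex.norm_real]
    calc Real.exp (-s.re * t) * ‖Real.exp (ψ * (m + 1)) * decodeProb f t (m + 1)‖
        ≤ Real.exp (-s.re * t) * (K * Real.exp (c * t) * ρ ^ m) := by
          gcongr
          exact hf.norm_expMoment_term_le hc.le ψ t m
      _ = K * ρ ^ m * (Real.exp (-s.re * t) * Real.exp (c * t)) := by ring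
      _ = _ := by rw [← Real.exp_add]; ring_nf
  have hE : IntegrableOn (fun t : ℝ => Real.exp (-(s.re - c) * t)) (Set.Ioi 0) :=
    integrableOn_exp_mul_Ioi (by linarith) 0
  have hAeq : ∀ m, A m = fun t : ℝ => ((Real.exp (ψ * (m + 1)) : ℝ) : ℂ) *
      (Complex.exp (-s * (t : ℂ)) * (failureProb f t m : ℂ) -
        Complex.exp (-s * (t : ℂ)) * (failureProb f t (m + 1) : ℂ)) := by
    intro m
    funext t
    simp only [hA, decodeProb_succ]
    push_cast
    ring
  have hAint : ∀ m, IntegrableOn (A m) (Set.Ioi 0) := by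
    intro m
    rw [hAeq]
    exact ((hf.integrableOn_exp_mul_failureProb hs0 m).sub
      (hf.integrableOn_exp_mul_failureProb hs0 (m + 1))).const_mul _
  have hAval : ∀ m, ∫ t in Set.Ioi (0 : ℝ), A m t =
      Complex.exp ψ * (1 - F) / s * (Complex.exp ψ * F) ^ m := by
    intro m
    have e1 := hf.laplace_failureProb hs0 m
    have e2 := hf.laplace_failureProb hs0 (m + 1)
    rw [laplace] at e1 e2
    rw [hAeq, integral_const_mul, integral_sub (hf.integrableOn_exp_mul_failureProb hs0 m)
      (hf.integrableOn_exp_mul_failureProb hs0 (m + 1)), e1, e2, mul_pow, ← Complex.exp_nat_mul]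
    push_cast
    rw [mul_add, mul_one, Complex.exp_add, mul_comm (ψ : ℂ)]
    ring
  have hnorm : Summable fun m => ∫ t in Set.Ioi (0 : ℝ), ‖A m t‖ := by
    refine Summable.of_nonneg_of_le (fun m => integral_nonneg fun t => norm_nonneg _)
      (fun m => ?_) ((hgeo.mul_left K).mul_right
        (∫ t in Set.Ioi (0 : ℝ), Real.exp (-(s.re - c) * t)))
    rw [← integral_const_mul]
    exact integral_mono (hAint m).norm (hE.const_mul _) (hAle m)
  have hsumA : ∀ t : ℝ, Complex.exp (-s * (t : ℂ)) * (expMoment f ψ t : ℂ) = ∑' m, A m t := by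
    intro t
    rw [hA, tsum_mul_left, expMoment, Complex.ofReal_tsum]
  have hFn : ‖Complex.exp ψ * F‖ < 1 := by
    refine lt_of_le_of_lt ?_ hlt
    rw [norm_mul, Complex.norm_exp, Complex.ofReal_re]
    exact mul_le_mul_of_nonneg_left (hf.norm_laplace_le hc.le hs.le) (Real.exp_pos _).le
  constructor
  · refine Integrable.mono' ((hE.const_mul (∑' m, K * ρ ^ m))) ?_ ?_
    · exact (ContinuousOn.mul (by fun_prop) hcont).aestronglyMeasurable measurableSet_Ioi
    · refine Eventually.of_forall fun t => ?_
      rw [hsumA, ← tsum_mul_right]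
      exact tsum_of_norm_bounded (((hgeo.mul_left K).mul_right _).hasSum) (fun m => hAle m t)
  · have h := hasSum_integral_of_summable_integral_norm hAint hnorm
    simp only [hAval] at h
    have h2 := (hasSum_geometric_of_norm_lt_one hFn).mul_left (Complex.exp ψ * (1 - F) / s)
    rw [laplace]
    simp only [hsumA]
    rw [h.unique h2, capacityTransform, ← hF, mul_comm F]
    ring

theorem IsChannelPdf.laplaceInv_eq (hf : IsChannelPdf f) (ψ : ℝ) {t : ℝ} (ht : 0 < t) :
    laplaceInv (capacityTransform f ψ) t = (expMoment f ψ t : ℂ) :=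
  (isLaplaceOriginal_laplaceInv (hf.isLaplaceOriginal_expMoment ψ)).eqOn
    (hf.isLaplaceOriginal_expMoment ψ) ht

theorem IsChannelPdf.tendsto_failureProb (hf : IsChannelPdf f) (t : ℝ) :
    Tendsto (failureProb f t) atTop (𝓝 0) := by
  obtain ⟨c, hc, hlt⟩ := hf.exists_realLaplace_lt (ψ := 0)
  rw [Real.exp_zero, one_mul] at hlt
  have h := (tendsto_pow_atTop_nhds_zero_of_lt_one (realLaplace_nonneg f c) hlt).const_mul
    (Real.exp (c * t))
  rw [mul_zero] at h
  exact squeeze_zero (failureProb_nonneg f t) (hf.failureProb_le hc.le t) h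

/-- The partial sums telescope to `1 - Q_n`, and `Q_n → 0`. -/
theorem IsChannelPdf.hasSum_decodeProb (hf : IsChannelPdf f) {t : ℝ} (ht : 0 < t) :
    HasSum (fun m => decodeProb f t (m + 1)) 1 := by
  have hs : Summable fun m => decodeProb f t (m + 1) := by
    simpa using hf.summable_expMoment 0 t
  refine (hs.hasSum_iff_tendsto_nat).2 ?_
  have h : ∀ n, ∑ m ∈ Finset.range n, decodeProb f t (m + 1) = 1 - failureProb f t n := by
    intro n
    simp only [decodeProb_succ]
    rw [Finset.sum_range_sub', failureProb_zero ht]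
  simp only [h]
  simpa using (hf.tendsto_failureProb t).const_sub 1

/-! ### Renewal structure of the packet count -/

variable {Θ : ℝ} {Ω : Type*} {T : ℕ → Ω → ℕ}

theorem decodedPackets_le (T : ℕ → Ω → ℕ) (k : ℕ) (ω : Ω) : decodedPackets T k ω ≤ k := by
  refine (Finset.card_filter_le _ _).trans ?_
  simp

theorem decodedPackets_of_lt {k : ℕ} {ω : Ω} (h : k < T 0 ω) : decodedPackets T k ω = 0 := by
  rw [decodedPackets, Finset.card_eq_zero, Finset.filter_eq_empty_iff]
  intro n hn hle
  have h1 : T 0 ω ≤ ∑ i ∈ Finset.range n, T i ω :=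
    Finset.single_le_sum (f := fun i => T i ω) (fun _ _ => Nat.zero_le _)
      (Finset.mem_range.2 (Finset.mem_Icc.1 hn).1)
  omega

/-- After a first cycle of length `m ≤ k`, the count starts afresh on the remaining `k - m` slots. -/
theorem decodedPackets_of_le {k : ℕ} {ω : Ω} (h1 : ∀ j, 1 ≤ T j ω) (h : T 0 ω ≤ k) :
    decodedPackets T k ω = decodedPackets (fun j => T (j + 1)) (k - T 0 ω) ω + 1 := by
  -- As each cycle lasts at least one slot, the cutoffs `n ≤ k` and `n ≤ k - T 0 ω` exclude nothing,
  -- and the two index sets match after a shift by one.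
  have hle : ∀ n, n ≤ ∑ i ∈ Finset.range n, T (i + 1) ω := by
    intro n
    calc n = ∑ i ∈ Finset.range n, 1 := by simp
      _ ≤ _ := Finset.sum_le_sum fun i _ => h1 (i + 1)
  have h0 := h1 0
  have hset : (Finset.Icc 1 k).filter (fun n => ∑ i ∈ Finset.range n, T i ω ≤ k) =
      insert 1 (((Finset.Icc 1 (k - T 0 ω)).filter
        (fun n => ∑ i ∈ Finset.range n, T (i + 1) ω ≤ k - T 0 ω)).map (addRightEmbedding 1)) := by
    ext n
    rcases n with _ | n
    · simp
    · have := hle n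
      simp only [Finset.mem_filter, Finset.mem_Icc, Finset.sum_range_succ', Finset.mem_insert,
        Finset.mem_map, addRightEmbedding_apply, Nat.add_right_cancel_iff, exists_eq_right]
      rcases n with _ | n
      · simp
        omega
      · omega
  rw [decodedPackets, hset, Finset.card_insert_of_notMem, Finset.card_map, decodedPackets]
  simp

variable [MeasurableSpace Ω] {μ : Measure Ω}

theorem IsPersistentHARQ.shift (hT : IsPersistentHARQ μ f Θ T) :
    IsPersistentHARQ μ f Θ (fun j => T (j + 1)) where
  measurable j := hT.measurable (j + 1)
  indep := hT.indep.precomp (add_left_injective 1)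
  law j := hT.law (j + 1)

theorem IsPersistentHARQ.decodeProb_nonneg (hT : IsPersistentHARQ μ f Θ T) (m : ℕ) :
    0 ≤ decodeProb f Θ (m + 1) := by
  rw [← hT.law 0 (m + 1) (by omega)]
  exact measureReal_nonneg

/-- The law is prescribed only for `m ≥ 1`; these masses already sum to `1`, leaving none for `T j =
0`. -/
theorem IsPersistentHARQ.ae_pos [IsProbabilityMeasure μ] (hT : IsPersistentHARQ μ f Θ T)
    (hf : IsChannelPdf f) (hΘ : 0 < Θ) : ∀ᵐ ω ∂μ, ∀ j, 1 ≤ T j ω := by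
  refine ae_all_iff.2 fun j => ?_
  have hm := hT.measurable j
  have := Measure.isProbabilityMeasure_map (μ := μ) hm.aemeasurable
  have h1 : ∫ _ : ℕ, (1 : ℝ) ∂(μ.map (T j)) = ∑' m, (μ.map (T j)).real {m} • (1 : ℝ) :=
    integral_countable (integrable_const _)
  have h2 : ∀ m, (μ.map (T j)).real {m} = μ.real {ω | T j ω = m} := fun m =>
    map_measureReal_apply hm (measurableSet_singleton m)
  have h3 : HasSum (fun m => μ.real {ω | T j ω = m + 1}) 1 := by
    simpa only [hT.law j _ (Nat.le_add_left 1 _)] using hf.hasSum_decodeProb hΘ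
  have h4 : Summable fun m => μ.real {ω | T j ω = m} := (summable_nat_add_iff 1).1 h3.summable
  simp only [h2, smul_eq_mul, mul_one, integral_const, probReal_univ] at h1
  rw [h4.tsum_eq_zero_add, h3.tsum_eq] at h1
  have h5 : μ.real {ω | T j ω = 0} = 0 := by linarith
  rw [measureReal_eq_zero_iff] at h5
  rw [ae_iff]
  simpa using h5

theorem measurable_decodedPackets (hT : ∀ j, Measurable (T j)) (k : ℕ) :
    Measurable (decodedPackets T k) := by
  have : decodedPackets T k = fun ω => ∑ n ∈ Finset.Icc 1 k,
      if ∑ i ∈ Finset.range n, T i ω ≤ k then 1 else 0 := by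
    funext ω
    rw [decodedPackets, Finset.card_filter]
  rw [this]
  refine Finset.measurable_sum _ fun n _ => Measurable.ite ?_ measurable_const measurable_const
  exact measurableSet_le (Finset.measurable_sum _ fun i _ => hT i) measurable_const

theorem IsPersistentHARQ.indepFun_decodedPackets (hT : IsPersistentHARQ μ f Θ T) (k : ℕ) :
    IndepFun (T 0) (decodedPackets (fun j => T (j + 1)) k) μ := by
  have h := hT.indep.indepFun_finset {0} (Finset.Icc 1 k) (by simp) hT.measurable
  have hX : Measurable (fun w : ({0} : Finset ℕ) → ℕ => w ⟨0, by simp⟩) := measurable_pi_apply _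
  -- The count up to slot `k` reads only `T 1, …, T k`, so padding by `0` outside this finite window
  -- does not change it.
  have hY : Measurable (decodedPackets (fun (i : ℕ) (w : (Finset.Icc 1 k : Finset ℕ) → ℕ) =>
      if h : i + 1 ∈ Finset.Icc 1 k then w ⟨i + 1, h⟩ else 0) k) := by
    refine measurable_decodedPackets (fun i => ?_) k
    by_cases hi : i + 1 ∈ Finset.Icc 1 k
    · simp only [hi, dif_pos]
      exact measurable_pi_apply _
    · simp only [hi, dif_neg, not_false_eq_true]
      exact measurable_const
  refine (h.comp hX hY).congr (Eventually.of_forall fun ω => rfl)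
    (Eventually.of_forall fun ω => Eq.symm ?_)
  simp only [Function.comp, decodedPackets]
  refine congrArg Finset.card ?_
  refine Finset.filter_congr fun n hn => ?_
  have hs : ∑ i ∈ Finset.range n, T (i + 1) ω = ∑ i ∈ Finset.range n,
      (if h : i + 1 ∈ Finset.Icc 1 k then T (i + 1) ω else 0) := by
    refine Finset.sum_congr rfl fun i hi => ?_
    rw [dif_pos]
    have := Finset.mem_range.1 hi
    have := Finset.mem_Icc.1 hn
    exact Finset.mem_Icc.2 (by omega)
  exact iff_of_eq (congrArg (· ≤ k) hs)

/-! ### Exponential decay of the packet transform -/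

/-- `𝔼[exp(-a N_k)]`. -/
noncomputable def packetTransform (μ : Measure Ω) (T : ℕ → Ω → ℕ) (a : ℝ) (k : ℕ) : ℝ :=
  ∫ ω, Real.exp (-a * (decodedPackets T k ω : ℝ)) ∂μ

theorem integrable_packet [IsProbabilityMeasure μ] (hT : ∀ j, Measurable (T j)) {a : ℝ}
    (ha : 0 ≤ a) (k : ℕ) :
    Integrable (fun ω => Real.exp (-a * (decodedPackets T k ω : ℝ))) μ := by
  have := measurable_decodedPackets hT k
  refine Integrable.mono' (integrable_const (1 : ℝ)) (by fun_prop) (Eventually.of_forall fun ω => ?_)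
  rw [Real.norm_eq_abs, Real.abs_exp, Real.exp_le_one_iff]
  have := mul_nonneg ha (Nat.cast_nonneg (α := ℝ) (decodedPackets T k ω))
  linarith

theorem exp_le_packetTransform [IsProbabilityMeasure μ] (hT : ∀ j, Measurable (T j)) {a : ℝ}
    (ha : 0 ≤ a) (k : ℕ) : Real.exp (-a * k) ≤ packetTransform μ T a k := by
  have h : ∫ _ : Ω, Real.exp (-a * k) ∂μ ≤ packetTransform μ T a k := by
    refine integral_mono (integrable_const _) (integrable_packet hT ha k) fun ω => ?_
    have : (decodedPackets T k ω : ℝ) ≤ k := by exact_mod_cast decodedPackets_le T k ω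
    have := mul_le_mul_of_nonneg_left this ha
    exact Real.exp_le_exp.2 (by linarith)
  simpa using h

/-- The renewal equation for `𝔼[exp(-a N_k)]`. -/
theorem IsPersistentHARQ.packetTransform_eq [IsProbabilityMeasure μ]
    (hT : IsPersistentHARQ μ f Θ T) (hf : IsChannelPdf f) (hΘ : 0 < Θ) {a : ℝ} (ha : 0 ≤ a)
    (k : ℕ) :
    packetTransform μ T a k = 1 + ∑ m ∈ Finset.range k, decodeProb f Θ (m + 1) *
      (Real.exp (-a) * packetTransform μ (fun j => T (j + 1)) a (k - (m + 1)) - 1) := by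
  -- If the first cycle outlasts `k`, the integrand is `1`. Writing every case as `1` plus a
  -- correction on `T 0 = m + 1 ≤ k` removes the tail probability from the equation.
  set X : ℕ → Ω → ℝ := fun m ω => if T 0 ω = m + 1 then 1 else 0 with hX
  set Y : ℕ → Ω → ℝ := fun m ω => Real.exp (-a) * Real.exp
    (-a * (decodedPackets (fun j => T (j + 1)) (k - (m + 1)) ω : ℝ)) - 1 with hY
  have hae : (fun ω => Real.exp (-a * (decodedPackets T k ω : ℝ))) =ᵐ[μ]
      fun ω => 1 + ∑ m ∈ Finset.range k, X m ω * Y m ω := by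
    filter_upwards [hT.ae_pos hf hΘ] with ω hω
    rcases lt_or_ge k (T 0 ω) with hk | hk
    · rw [decodedPackets_of_lt hk, Finset.sum_eq_zero]
      · simp
      · intro m hm
        have := Finset.mem_range.1 hm
        have : T 0 ω ≠ m + 1 := by omega
        simp [hX, this]
    · have h0 := hω 0
      rw [Finset.sum_eq_single (T 0 ω - 1)]
      · simp only [hX, hY, Nat.sub_add_cancel h0, if_true]
        rw [decodedPackets_of_le hω hk, ← Real.exp_add]
        push_cast
        ring_nf
      · intro m _ hm
        have : T 0 ω ≠ m + 1 := by omega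
        simp [hX, this]
      · intro hm
        exact absurd (Finset.mem_range.2 (by omega)) hm
  have hXint : ∀ m, ∫ ω, X m ω ∂μ = decodeProb f Θ (m + 1) := by
    intro m
    rw [← hT.law 0 (m + 1) (by omega)]
    have hs : MeasurableSet {ω | T 0 ω = m + 1} := hT.measurable 0 (measurableSet_singleton _)
    rw [← integral_indicator_one hs]
    refine integral_congr_ae (Eventually.of_forall fun ω => ?_)
    simp [hX, Set.indicator]
  have hYint : ∀ m, Integrable (Y m) μ := fun m =>
    ((integrable_packet hT.shift.measurable ha _).const_mul _).sub (integrable_const _)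
  have hXm : ∀ m, Measurable fun n : ℕ => if n = m + 1 then (1 : ℝ) else 0 := fun m =>
    measurable_of_countable _
  have hXY : ∀ m, IndepFun (X m) (Y m) μ := fun m =>
    (hT.indepFun_decodedPackets (k - (m + 1))).comp (hXm m)
      (ψ := fun n : ℕ => Real.exp (-a) * Real.exp (-a * (n : ℝ)) - 1) (measurable_of_countable _)
  have hXi : ∀ m, Integrable (X m) μ := fun m =>
    Integrable.mono' (integrable_const (1 : ℝ)) ((hXm m).comp (hT.measurable 0)).aestronglyMeasurable
      (Eventually.of_forall fun ω => by simp only [hX]; split_ifs <;> simp)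
  have hXYi : ∀ m, Integrable (fun ω => X m ω * Y m ω) μ := fun m =>
    (hXY m).integrable_mul (hXi m) (hYint m)
  rw [packetTransform, integral_congr_ae hae, integral_add (integrable_const _)
    (integrable_finsetSum _ fun m _ => hXYi m), integral_finsetSum _ fun m _ => hXYi m]
  congr 1
  · simp
  · refine Finset.sum_congr rfl fun m _ => ?_
    rw [(hXY m).integral_fun_mul_eq_mul_integral (hXi m).aestronglyMeasurable
      (hYint m).aestronglyMeasurable, hXint]
    congr 1
    simp only [hY]
    rw [integral_sub ((integrable_packet hT.shift.measurable ha _).const_mul _)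
      (integrable_const _), integral_const_mul]
    simp [packetTransform]

theorem IsChannelPdf.hasSum_expMoment (hf : IsChannelPdf f) (ψ t : ℝ) :
    HasSum (fun m : ℕ => Real.exp (ψ * (m + 1)) * decodeProb f t (m + 1)) (expMoment f ψ t) :=
  (hf.summable_expMoment ψ t).hasSum

/-- Since `M(l) = e^a`, the bound `e^{a - lk}` solves the renewal equation with the sum extended to
all `m`; the added terms are nonnegative because `l(m + 1 - k) ≥ 0` there. The induction varies `T`,
as the recursion passes to the shifted cycles. -/
theorem IsPersistentHARQ.packetTransform_le [IsProbabilityMeasure μ]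
    (hT : IsPersistentHARQ μ f Θ T) (hf : IsChannelPdf f) (hΘ : 0 < Θ) {a l : ℝ} (ha : 0 ≤ a)
    (hl : 0 ≤ l) (hM : expMoment f l Θ = Real.exp a) (k : ℕ) :
    packetTransform μ T a k ≤ Real.exp (a - l * k) := by
  induction k using Nat.strong_induction_on generalizing T with
  | _ k ih =>
  rw [hT.packetTransform_eq hf hΘ ha]
  have h1 : HasSum (fun m : ℕ => decodeProb f Θ (m + 1) * (Real.exp (l * (m + 1 - k)) - 1))
      (Real.exp (a - l * k) - 1) := by
    have := ((hf.hasSum_expMoment l Θ).mul_left (Real.exp (-(l * k)))).sub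
      (hf.hasSum_decodeProb hΘ)
    rw [hM, ← Real.exp_add, neg_add_eq_sub] at this
    have e : ∀ m : ℕ, decodeProb f Θ (m + 1) * (Real.exp (l * (m + 1 - k)) - 1) =
        Real.exp (-(l * k)) * (Real.exp (l * (m + 1)) * decodeProb f Θ (m + 1)) -
          decodeProb f Θ (m + 1) := by
      intro m
      rw [← mul_assoc, ← Real.exp_add, mul_sub, mul_one, mul_comm]
      ring_nf
    simp only [e]
    exact this
  have h2 := sum_le_hasSum (Finset.range k) (fun m hm => by
    have hk : (k : ℝ) ≤ m + 1 := by
      have : k ≤ m := by simpa using hm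
      exact_mod_cast this.trans (Nat.le_succ m)
    exact mul_nonneg (hT.decodeProb_nonneg m)
      (sub_nonneg.2 (Real.one_le_exp (mul_nonneg hl (sub_nonneg.2 hk))))) h1
  have h3 : ∑ m ∈ Finset.range k, decodeProb f Θ (m + 1) *
      (Real.exp (-a) * packetTransform μ (fun j => T (j + 1)) a (k - (m + 1)) - 1) ≤
      ∑ m ∈ Finset.range k, decodeProb f Θ (m + 1) * (Real.exp (l * (m + 1 - k)) - 1) := by
    refine Finset.sum_le_sum fun m hm => ?_
    have hmk : m + 1 ≤ k := Finset.mem_range.1 hm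
    refine mul_le_mul_of_nonneg_left (sub_le_sub_right ?_ 1) (hT.decodeProb_nonneg m)
    have h4 := ih (k - (m + 1)) (by omega) hT.shift
    calc _ ≤ Real.exp (-a) * Real.exp (a - l * (k - (m + 1) : ℕ)) := by gcongr
      _ = _ := by
        rw [← Real.exp_add]
        push_cast [hmk]
        ring_nf
  linarith

/-- Keeping only first cycles of length at most `L` means that none overshoots when `k ≥ L`. For `k
< L` the trivial bound `N_k ≤ k` suffices, at the price of the factor `e^{-aL}`. -/
theorem IsPersistentHARQ.le_packetTransform [IsProbabilityMeasure μ]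
    (hT : IsPersistentHARQ μ f Θ T) (hf : IsChannelPdf f) (hΘ : 0 < Θ) {a l : ℝ} (ha : 0 ≤ a)
    (hl : 0 ≤ l) {L : ℕ} (hL : Real.exp a ≤
      ∑ m ∈ Finset.range L, Real.exp (l * (m + 1)) * decodeProb f Θ (m + 1)) (k : ℕ) :
    Real.exp (-(a * L) - l * k) ≤ packetTransform μ T a k := by
  induction k using Nat.strong_induction_on generalizing T with
  | _ k ih =>
  rcases lt_or_ge k L with hk | hk
  · refine le_trans (Real.exp_le_exp.2 ?_) (exp_le_packetTransform hT.measurable ha k)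
    have h1 : (k : ℝ) ≤ L := by exact_mod_cast hk.le
    have h2 := mul_le_mul_of_nonneg_left h1 ha
    have h3 := mul_nonneg hl (Nat.cast_nonneg (α := ℝ) k)
    linarith
  · rw [hT.packetTransform_eq hf hΘ ha]
    set u := fun m => Real.exp (-a) * packetTransform μ (fun j => T (j + 1)) a (k - (m + 1)) with hu
    have hu0 : ∀ m, 0 ≤ u m := fun m => mul_nonneg (Real.exp_pos _).le
      (integral_nonneg fun _ => (Real.exp_pos _).le)
    have h1 : ∑ m ∈ Finset.range k, decodeProb f Θ (m + 1) ≤ 1 :=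
      sum_le_hasSum _ (fun m _ => hT.decodeProb_nonneg m) (hf.hasSum_decodeProb hΘ)
    have h2 : ∑ m ∈ Finset.range L, decodeProb f Θ (m + 1) * u m ≤
        ∑ m ∈ Finset.range k, decodeProb f Θ (m + 1) * u m :=
      Finset.sum_le_sum_of_subset_of_nonneg (Finset.range_subset_range.2 hk)
        fun m _ _ => mul_nonneg (hT.decodeProb_nonneg m) (hu0 m)
    have h3 : Real.exp (-(a * L) - l * k - a) *
        ∑ m ∈ Finset.range L, Real.exp (l * (m + 1)) * decodeProb f Θ (m + 1) ≤
        ∑ m ∈ Finset.range L, decodeProb f Θ (m + 1) * u m := by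
      rw [Finset.mul_sum]
      refine Finset.sum_le_sum fun m hm => ?_
      have hmk : m + 1 ≤ k := (Finset.mem_range.1 hm).trans_le hk
      have h4 := ih (k - (m + 1)) (by omega) hT.shift
      have h5 : Real.exp (-(a * L) - l * k - a) * Real.exp (l * (m + 1)) ≤ u m := by
        calc _ = Real.exp (-a) * Real.exp (-(a * L) - l * (k - (m + 1) : ℕ)) := by
              rw [← Real.exp_add, ← Real.exp_add]
              push_cast [hmk]
              ring_nf
          _ ≤ u m := by
              simp only [hu]
              gcongr
      rw [← mul_assoc, mul_comm]
      exact mul_le_mul_of_nonneg_left h5 (hT.decodeProb_nonneg m)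
    have h6 := mul_le_mul_of_nonneg_left hL (Real.exp_pos (-(a * L) - l * k - a)).le
    rw [← Real.exp_add, sub_add_cancel] at h6
    -- The remainder `1 - ∑ P_m`, over `m ≤ k`, is nonnegative by `h1` and is dropped.
    simp only [mul_sub, mul_one, Finset.sum_sub_distrib]
    linarith

/-! ### Solving for the exponent and the effective capacity -/

/-- Cycles last at least one slot, so raising `l` to `l'` gains a factor of at least `e^{l' - l}` in
each term. This gives strict monotonicity and `M(l) ≥ e^l`. -/
theorem IsPersistentHARQ.exp_mul_expMoment_le (hT : IsPersistentHARQ μ f Θ T)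
    (hf : IsChannelPdf f) {l l' : ℝ} (hl : l ≤ l') :
    Real.exp (l' - l) * expMoment f l Θ ≤ expMoment f l' Θ := by
  refine hasSum_le (fun m => ?_) ((hf.hasSum_expMoment l Θ).mul_left _) (hf.hasSum_expMoment l' Θ)
  rw [← mul_assoc, ← Real.exp_add]
  refine mul_le_mul_of_nonneg_right (Real.exp_le_exp.2 ?_) (hT.decodeProb_nonneg m)
  have := mul_nonneg (sub_nonneg.2 hl) (Nat.cast_nonneg (α := ℝ) m)
  linarith

theorem IsChannelPdf.expMoment_zero (hf : IsChannelPdf f) (hΘ : 0 < Θ) : expMoment f 0 Θ = 1 := by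
  simpa [expMoment] using (hf.hasSum_decodeProb hΘ).tsum_eq

theorem IsPersistentHARQ.exp_le_expMoment (hT : IsPersistentHARQ μ f Θ T)
    (hf : IsChannelPdf f) (hΘ : 0 < Θ) {l : ℝ} (hl : 0 ≤ l) :
    Real.exp l ≤ expMoment f l Θ := by
  simpa [hf.expMoment_zero hΘ] using hT.exp_mul_expMoment_le hf hl

/-- Intermediate values on `[0, a]`, as `M(0) = 1 ≤ e^a ≤ M(a)`. -/
theorem IsPersistentHARQ.exists_expMoment_eq (hT : IsPersistentHARQ μ f Θ T)
    (hf : IsChannelPdf f) (hΘ : 0 < Θ) {a : ℝ} (ha : 0 ≤ a) :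
    ∃ l, 0 ≤ l ∧ expMoment f l Θ = Real.exp a := by
  have hc : ContinuousOn (fun l => expMoment f l Θ) (Set.Icc 0 a) := by
    refine continuousOn_tsum (fun m => by fun_prop) (hf.summable_expMoment a Θ) ?_
    intro m l hl
    have := hT.decodeProb_nonneg m
    rw [Real.norm_of_nonneg (mul_nonneg (Real.exp_pos _).le this)]
    have := hl.2
    gcongr
  obtain ⟨l, hl, h⟩ := intermediate_value_Icc ha hc (show Real.exp a ∈ _ from
    ⟨by simpa only [hf.expMoment_zero hΘ] using Real.one_le_exp ha, hT.exp_le_expMoment hf hΘ ha⟩)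
  exact ⟨l, hl.1, h⟩

/-- The effective capacity is `l / θ`, where `l` is the exponent for which the exponential moment
of the cycle length is `e^{θ R}`. -/
theorem IsPersistentHARQ.isEffectiveCapacity [IsProbabilityMeasure μ]
    (hT : IsPersistentHARQ μ f Θ T) (hf : IsChannelPdf f) (hΘ : 0 < Θ) {R θ l : ℝ} (hR : 0 < R)
    (hθ : 0 < θ) (hl : 0 ≤ l) (hM : expMoment f l Θ = Real.exp (θ * R)) :
    IsEffectiveCapacity μ R (decodedPackets T) θ (l / θ) := by
  have ha : 0 ≤ θ * R := by positivity
  have heq : ∀ k : ℕ, ∫ ω, Real.exp (-θ * R * (decodedPackets T k ω : ℝ)) ∂μ =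
      packetTransform μ T (θ * R) k := fun k => by simp only [packetTransform, neg_mul]
  have hpos : ∀ k, 0 < packetTransform μ T (θ * R) k := fun k =>
    (Real.exp_pos _).trans_le (exp_le_packetTransform hT.measurable ha k)
  have hzero : ∀ C : ℝ, Tendsto (fun k : ℕ => C / (θ * (k : ℝ))) atTop (𝓝 0) := fun C =>
    (tendsto_natCast_atTop_atTop.const_mul_atTop hθ).const_div_atTop C
  unfold IsEffectiveCapacity
  simp only [heq]
  rw [tendsto_order]
  constructor
  · intro b hb
    have h1 := (hzero (θ * R)).const_sub (l / θ)
    rw [sub_zero] at h1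
    filter_upwards [h1.eventually_const_lt hb, eventually_gt_atTop 0] with k hk hk0
    refine hk.trans_le ?_
    have hk0' : (0 : ℝ) < k := by exact_mod_cast hk0
    have h2 := (Real.log_le_iff_le_exp (hpos k)).2 (hT.packetTransform_le hf hΘ ha hl hM k)
    have h3 := mul_le_mul_of_nonneg_left h2 (show (0 : ℝ) ≤ 1 / (θ * k) by positivity)
    have h4 : 1 / (θ * (k : ℝ)) * (θ * R - l * k) = θ * R / (θ * k) - l / θ := by
      field_simp
    linarith
  · intro b hb
    -- The slightly larger exponent `cθ > l` makes `M(cθ) > e^{θR}` strict, so a finite partial sum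
    -- already exceeds `e^{θR}` and supplies `L`.
    obtain ⟨c, hc1, hc2⟩ := exists_between hb
    have hlc : l < c * θ := (div_lt_iff₀ hθ).1 hc1
    have hlt : Real.exp (θ * R) < expMoment f (c * θ) Θ := by
      refine lt_of_lt_of_le ?_ (hT.exp_mul_expMoment_le hf hlc.le)
      rw [hM]
      have := Real.one_lt_exp_iff.2 (sub_pos.2 hlc)
      exact lt_mul_of_one_lt_left (Real.exp_pos _) this
    obtain ⟨L, hL⟩ := ((hf.hasSum_expMoment (c * θ) Θ).tendsto_sum_nat.eventually_const_lt hlt).exists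
    have h1 := (hzero (θ * R * L)).const_add c
    rw [add_zero] at h1
    filter_upwards [h1.eventually_lt_const hc2, eventually_gt_atTop 0] with k hk hk0
    refine lt_of_le_of_lt ?_ hk
    have hk0' : (0 : ℝ) < k := by exact_mod_cast hk0
    have h2 := (Real.le_log_iff_exp_le (hpos k)).2
      (hT.le_packetTransform hf hΘ ha (hl.trans hlc.le) hL.le k)
    have h3 := mul_le_mul_of_nonneg_left h2 (show (0 : ℝ) ≤ 1 / (θ * k) by positivity)
    have h4 : 1 / (θ * (k : ℝ)) * (-(θ * R * L) - c * θ * k) = -(θ * R * L / (θ * k)) - c := by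
      field_simp
    linarith

end HARQ

theorem corollary9 {Ω : Type*} [MeasurableSpace Ω] (μ : Measure Ω) [IsProbabilityMeasure μ]
    (f : ℝ → ℝ) (hf : HARQ.IsChannelPdf f) (Θ : ℝ) (hΘ : 0 < Θ) (R : ℝ) (hR : 0 < R)
    (T : ℕ → Ω → ℕ) (hT : HARQ.IsPersistentHARQ μ f Θ T)
    (η ε D : ℝ) (hε : 0 < ε) (hεη : ε < η) (hD : 0 < D)
    (ψ : ℝ) (hψ : ψ = HARQ.qosParameter η ε D) :
    HARQ.IsLaplaceOriginal (HARQ.capacityTransform f ψ)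
        (HARQ.laplaceInv (HARQ.capacityTransform f ψ)) ∧
      ∃ x : ℝ, 1 < x ∧ HARQ.laplaceInv (HARQ.capacityTransform f ψ) Θ = (x : ℂ) ∧
        ∀ C : ℝ, HARQ.IsEffectiveCapacityAt μ R (HARQ.decodedPackets T) ψ C ↔
          C = R / (ψ⁻¹ * Real.log x) := by
  have hψ0 : 0 < ψ := by
    rw [hψ]
    exact div_pos (Real.log_pos ((one_lt_div hε).2 hεη)) hD
  have hx1 : 1 < HARQ.expMoment f ψ Θ :=
    (Real.one_lt_exp_iff.2 hψ0).trans_le (hT.exp_le_expMoment hf hΘ hψ0.le)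
  refine ⟨HARQ.isLaplaceOriginal_laplaceInv (hf.isLaplaceOriginal_expMoment ψ),
    HARQ.expMoment f ψ Θ, hx1, hf.laplaceInv_eq ψ hΘ, fun C => ⟨?_, ?_⟩⟩
  -- Uniqueness: for any admissible `θ` the limit is `l / θ` with `M(l) = e^{θR}`, and `θC = ψ`
  -- forces `l = ψ`.
  · rintro ⟨θ, hθ, hC, hθC⟩
    obtain ⟨l, hl, hM⟩ := hT.exists_expMoment_eq hf hΘ (mul_pos hθ hR).le
    have hCl : C = l / θ := tendsto_nhds_unique hC (hT.isEffectiveCapacity hf hΘ hR hθ hl hM)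
    have hlψ : l = ψ := by
      rw [← hθC, hCl]
      field_simp
    rw [← hlψ, hM, Real.log_exp, hCl]
    rw [← hlψ] at hψ0
    field_simp
  · have hlog : 0 < Real.log (HARQ.expMoment f ψ Θ) := Real.log_pos hx1
    have hθ : 0 < Real.log (HARQ.expMoment f ψ Θ) / R := div_pos hlog hR
    intro hC
    -- The witness `θ*` is the solution of `e^{θR} = M(ψ)`.
    refine ⟨Real.log (HARQ.expMoment f ψ Θ) / R, hθ, ?_, ?_⟩
    · have h := hT.isEffectiveCapacity hf hΘ hR hθ hψ0.le
        (by rw [div_mul_cancel₀ _ hR.ne', Real.exp_log (one_pos.trans hx1)])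
      convert h using 1
      rw [hC]
      field_simp
    · rw [hC]
      field_simp
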